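/- A C*-ternary ring is a complex Banach space $M$ with a triple product $(x,y,z)\mapsto [xyz]\in M$, linear in $x$ and $z$ and conjugate-linear in $y$, such that $[[xyz]uv]=[x[uzy]v]=[xy[zuv]]$, $\|[xyz]\|\le\|x\|\|y\|\|z\|$ and $\|[xxx]\|=\|x\|^3$. Let $M$ be a C*-ternary ring. Let $E(M)=B(M)\oplus\overline{B(M)}^{\,op}$ be the *-algebra of pairs $(A_1,A_2)$ of bounded operators on $M$ with the maximum norm, product $(A_1,A_2)(B_1,B_2)=(A_1B_1,B_2A_2)$, scalar multiplication $c(A_1,A_2)=(cA_1,\bar cA_2)$ and involution $\overline{(A_1,A_2)}=(A_2,A_1)$. Put $\ell(x,y)=([xy\,\cdot\,],[yx\,\cdot\,])$ and $r(u,v)=([\,\cdot\,uv],[\,\cdot\,vu])$, and let $L(M)$ and $R(M)$ be the norm closures in $E(M)$ of the linear spans of all $\ell(x,y)$ and of all $r(u,v)$, respectively; $R(M)$ is a C*-algebra. Let $R(M)^{op}$ be $R(M)$ with the product $B\circ B'=B'B$, and let $\overline M$ be the conjugate space of $M$. For $A\in L(M)$, $B\in R(M)$ and $f,g\in M$ put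 $A\cdot f=A_1f$, $f\cdot B=B_1f$, $\overline g\cdot A=\overline{A_2g}$ and $B\cdot\overline g=\overline{B_2g}$. The normed standard embedding of $M$ is the *-algebra $$\mathcal A(M)=\left\{\begin{bmatrix}A&f\\ \overline g&B\end{bmatrix}: A\in L(M),\ f,g\in M,\ B\in R(M)^{op}\right\}$$ with $$\begin{bmatrix}A&f\\ \overline g&B\end{bmatrix}\begin{bmatrix}A'&f'\\ \overline{g'}&B'\end{bmatrix}=\begin{bmatrix}AA'+\ell(f,g')&A\cdot f'+f\cdot B'\\ \overline g\cdot A'+B\cdot\overline{g'}&r(g,f')+B\circ B'\end{bmatrix},\qquad \begin{bmatrix}A&f\\ \overline g&B\end{bmatrix}^{\#}=\begin{bmatrix}\overline A&g\\ \overline f&\overline B\end{bmatrix}.$$ We say that $\mathcal A(M)$ can be normed to be a C*-algebra if there is a complete submultiplicative norm $\nu$ on the *-algebra $\mathcal A(M)$ with $\nu(a^{\#}a)=\nu(a)^2$ for all $a$. We say that $M$ is a right $R(M)^{op}$-Hilbert module if $M$, with its given norm, with the right action $(f,B)\mapsto f\cdot B$ of $R(M)^{op}$ and with the inner product $\langle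 f,g\rangle=r(g,f)$ (the one for which $[fgh]=f\cdot\langle h,g\rangle$), is a Hilbert C*-module: $\langle\cdot,\cdot\rangle$ is linear in the first variable, $\langle f\cdot B,g\rangle=\langle f,g\rangle\circ B$, $\langle f,g\rangle^*=\langle g,f\rangle$, $\langle f,f\rangle\ge 0$ in the C*-algebra $R(M)^{op}$, $\langle f,f\rangle=0$ only for $f=0$, and $\|f\|^2=\|\langle f,f\rangle\|$. **Proposition.** For every C*-ternary ring $M$, the normed standard embedding $\mathcal A(M)$ can be normed to be a C*-algebra if and only if $M$ is a right $R(M)^{op}$-Hilbert module. -/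

import Mathlib

open scoped ComplexConjugate

noncomputable section

/-- A C*-ternary ring: a complex Banach space `M` with a triple product `tri x y z = [xyz]`, linear
in the outer variables and conjugate-linear in the middle one, satisfying
`[[xyz]uv] = [x[uzy]v] = [xy[zuv]]`, `‖[xyz]‖ ≤ ‖x‖‖y‖‖z‖` and `‖[xxx]‖ = ‖x‖³`. -/
class CStarTernaryRing (M : Type*) [NormedAddCommGroup M] [NormedSpace ℂ M]
    extends CompleteSpace M where
  tri : M → M → M → M
  tri_add_left : ∀ x x' y z, tri (x + x') y z = tri x y z + tri x' y z
  tri_smul_left : ∀ (c : ℂ) (x y z), tri (c • x) y z = c • tri x y z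
  tri_add_mid : ∀ x y y' z, tri x (y + y') z = tri x y z + tri x y' z
  tri_smul_mid : ∀ (c : ℂ) (x y z), tri x (c • y) z = conj c • tri x y z
  tri_add_right : ∀ x y z z', tri x y (z + z') = tri x y z + tri x y z'
  tri_smul_right : ∀ (c : ℂ) (x y z), tri x y (c • z) = c • tri x y z
  tri_assoc_mid : ∀ x y z u v, tri (tri x y z) u v = tri x (tri u z y) v
  tri_assoc_right : ∀ x y z u v, tri (tri x y z) u v = tri x y (tri z u v)
  norm_tri_le : ∀ x y z, ‖tri x y z‖ ≤ ‖x‖ * ‖y‖ * ‖z‖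
  norm_tri_self : ∀ x, ‖tri x x x‖ = ‖x‖ ^ 3

namespace CStarTernaryRing

/-! ### The Banach *-algebra `E(M)` of pairs of operators -/

/-- `E(M) = B(M) ⊕ conj(B(M))ᵒᵖ`: pairs `(A₁, A₂)` of bounded operators with the maximum norm,
product `(A₁, A₂)(B₁, B₂) = (A₁B₁, B₂A₂)`, scalar multiplication `c(A₁, A₂) = (cA₁, c̄A₂)` and
involution `(A₁, A₂)* = (A₂, A₁)`. -/
def EndPair (M : Type*) [NormedAddCommGroup M] [NormedSpace ℂ M] : Type _ :=
  (M →L[ℂ] M) × (M →L[ℂ] M)ᵐᵒᵖ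

namespace EndPair

variable {M : Type*} [NormedAddCommGroup M] [NormedSpace ℂ M]

instance : NonUnitalNormedRing (EndPair M) :=
  inferInstanceAs (NonUnitalNormedRing ((M →L[ℂ] M) × (M →L[ℂ] M)ᵐᵒᵖ))

instance [CompleteSpace M] : CompleteSpace (EndPair M) :=
  inferInstanceAs (CompleteSpace ((M →L[ℂ] M) × (M →L[ℂ] M)ᵐᵒᵖ))

def mk (S T : M →L[ℂ] M) : EndPair M := (S, MulOpposite.op T)

def fst (A : EndPair M) : M →L[ℂ] M := Prod.fst A

def snd (A : EndPair M) : M →L[ℂ] M := MulOpposite.unop (Prod.snd A)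

@[ext] theorem ext {A B : EndPair M} (h₁ : A.fst = B.fst) (h₂ : A.snd = B.snd) : A = B :=
  Prod.ext h₁ (MulOpposite.unop_injective h₂)

@[simp] theorem fst_mk (S T : M →L[ℂ] M) : (mk S T).fst = S := rfl
@[simp] theorem snd_mk (S T : M →L[ℂ] M) : (mk S T).snd = T := rfl
@[simp] theorem fst_zero : (0 : EndPair M).fst = 0 := rfl
@[simp] theorem snd_zero : (0 : EndPair M).snd = 0 := rfl
@[simp] theorem fst_add (A B : EndPair M) : (A + B).fst = A.fst + B.fst := rfl
@[simp] theorem snd_add (A B : EndPair M) : (A + B).snd = A.snd + B.snd := rfl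
@[simp] theorem fst_neg (A : EndPair M) : (-A).fst = -A.fst := rfl
@[simp] theorem snd_neg (A : EndPair M) : (-A).snd = -A.snd := rfl
@[simp] theorem fst_mul (A B : EndPair M) : (A * B).fst = A.fst * B.fst := rfl
@[simp] theorem snd_mul (A B : EndPair M) : (A * B).snd = B.snd * A.snd := rfl

theorem norm_def (A : EndPair M) : ‖A‖ = max ‖A.fst‖ ‖A.snd‖ := rfl

theorem continuous_fst : Continuous (fst : EndPair M → _) :=
  _root_.continuous_fst (X := M →L[ℂ] M) (Y := (M →L[ℂ] M)ᵐᵒᵖ)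

theorem continuous_snd : Continuous (snd : EndPair M → _) :=
  MulOpposite.continuous_unop.comp
    (_root_.continuous_snd (X := M →L[ℂ] M) (Y := (M →L[ℂ] M)ᵐᵒᵖ))

instance : SMul ℂ (EndPair M) := ⟨fun c A => mk (c • A.fst) (conj c • A.snd)⟩

@[simp] theorem fst_smul (c : ℂ) (A : EndPair M) : (c • A).fst = c • A.fst := rfl
@[simp] theorem snd_smul (c : ℂ) (A : EndPair M) : (c • A).snd = conj c • A.snd := rfl

instance : Module ℂ (EndPair M) where
  one_smul A := by ext <;> simp
  mul_smul c d A := by ext <;> simp [mul_smul]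
  smul_zero c := by ext <;> simp
  smul_add c A B := by ext <;> simp
  add_smul c d A := by ext <;> simp [add_smul]
  zero_smul A := by ext <;> simp

instance : NormedSpace ℂ (EndPair M) where
  norm_smul_le c A := by
    rw [norm_def, norm_def, fst_smul, snd_smul, norm_smul, norm_smul, RCLike.norm_conj,
      mul_max_of_nonneg _ _ (norm_nonneg c)]

instance : IsScalarTower ℂ (EndPair M) (EndPair M) where
  smul_assoc c A B := by ext <;> simp

instance : SMulCommClass ℂ (EndPair M) (EndPair M) where
  smul_comm c A B := by ext <;> simp

instance : StarRing (EndPair M) where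
  star A := mk A.snd A.fst
  star_involutive _ := rfl
  star_mul _ _ := rfl
  star_add _ _ := rfl

@[simp] theorem fst_star (A : EndPair M) : (star A).fst = A.snd := rfl
@[simp] theorem snd_star (A : EndPair M) : (star A).snd = A.fst := rfl

instance : NormedStarGroup (EndPair M) where
  norm_star_le A := by rw [norm_def, norm_def, fst_star, snd_star, max_comm]

instance : StarModule ℂ (EndPair M) where
  star_smul c A := by ext <;> simp

/-- A closed linear condition on `E(M)` passes to the closed linear span. -/
theorem closed_induction {s : Set (EndPair M)} {P : EndPair M → Prop}
    (hclosed : IsClosed {A | P A}) (hmem : ∀ A ∈ s, P A) (hzero : P 0)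
    (hadd : ∀ A B, P A → P B → P (A + B)) (hsmul : ∀ (c : ℂ) A, P A → P (c • A))
    {A : EndPair M} (hA : A ∈ closure (Submodule.span ℂ s : Set (EndPair M))) : P A := by
  refine closure_minimal (t := {A | P A}) (fun B hB => ?_) hclosed hA
  exact Submodule.span_induction (p := fun B _ => P B) hmem hzero
    (fun x y _ _ hx hy => hadd x y hx hy) (fun c x _ hx => hsmul c x hx) hB

theorem continuous_fst_apply (x : M) : Continuous fun A : EndPair M => A.fst x :=
  (ContinuousLinearMap.apply ℂ M x).continuous.comp continuous_fst

theorem continuous_snd_apply (x : M) : Continuous fun A : EndPair M => A.snd x :=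
  (ContinuousLinearMap.apply ℂ M x).continuous.comp continuous_snd

end EndPair

variable {M : Type*} [NormedAddCommGroup M] [NormedSpace ℂ M] [CStarTernaryRing M]

/-! ### The C*-algebras `L(M)` and `R(M)` -/

/-- `L(x, y) = [x y ·]`. -/
def leftMul (x y : M) : M →L[ℂ] M :=
  LinearMap.mkContinuous
    { toFun := fun z => tri x y z
      map_add' := tri_add_right x y
      map_smul' := fun c z => tri_smul_right c x y z } (‖x‖ * ‖y‖) (norm_tri_le x y)

/-- `R(y, z) = [· y z]`. -/
def rightMul (y z : M) : M →L[ℂ] M :=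
  LinearMap.mkContinuous
    { toFun := fun x => tri x y z
      map_add' := fun x x' => tri_add_left x x' y z
      map_smul' := fun c x => tri_smul_left c x y z } (‖y‖ * ‖z‖)
    (fun x => (norm_tri_le x y z).trans_eq (by ring))

@[simp] theorem leftMul_apply (x y z : M) : leftMul x y z = tri x y z := rfl
@[simp] theorem rightMul_apply (y z x : M) : rightMul y z x = tri x y z := rfl

/-- `ℓ(x, y) = ([x y ·], [y x ·])`. -/
def ellPair (x y : M) : EndPair M := EndPair.mk (leftMul x y) (leftMul y x)

/-- `r(u, v) = ([· u v], [· v u])`. -/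
def rPair (u v : M) : EndPair M := EndPair.mk (rightMul u v) (rightMul v u)

@[simp] theorem fst_ellPair (x y : M) : (ellPair x y).fst = leftMul x y := rfl
@[simp] theorem snd_ellPair (x y : M) : (ellPair x y).snd = leftMul y x := rfl
@[simp] theorem fst_rPair (x y : M) : (rPair x y).fst = rightMul x y := rfl
@[simp] theorem snd_rPair (x y : M) : (rPair x y).snd = rightMul y x := rfl

@[simp] theorem star_ellPair (x y : M) : star (ellPair x y) = ellPair y x := rfl
@[simp] theorem star_rPair (x y : M) : star (rPair x y) = rPair y x := rfl

theorem tri_mid_right (x y z u v : M) : tri x (tri u z y) v = tri x y (tri z u v) := by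
  rw [← tri_assoc_mid, tri_assoc_right]

theorem ellPair_mul (x y u v : M) : ellPair x y * ellPair u v = ellPair x (tri v u y) := by
  ext w <;> simp [tri_mid_right, tri_assoc_right]

theorem rPair_mul (x y u v : M) : rPair x y * rPair u v = rPair u (tri v x y) := by
  ext w <;> simp [tri_assoc_mid, tri_mid_right]

/-- The span of a self-adjoint, multiplicatively closed set, as a *-subalgebra. -/
def spanStarSubalgebra (s : Set (EndPair M)) (hm : ∀ a ∈ s, ∀ b ∈ s, a * b ∈ s)
    (hs : ∀ a ∈ s, star a ∈ s) : NonUnitalStarSubalgebra ℂ (EndPair M) where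
  toSubmodule := Submodule.span ℂ s
  mul_mem' := by
    intro a b ha hb
    have key : ∀ a ∈ Submodule.span ℂ s, ∀ b ∈ Submodule.span ℂ s, a * b ∈ Submodule.span ℂ s := by
      intro a ha b hb
      induction ha using Submodule.span_induction with
      | mem x hx =>
        induction hb using Submodule.span_induction with
        | mem y hy => exact Submodule.subset_span (hm x hx y hy)
        | zero => simp
        | add y z _ _ h₁ h₂ => rw [mul_add]; exact add_mem h₁ h₂
        | smul c y _ h => rw [mul_smul_comm]; exact Submodule.smul_mem _ c h
      | zero => simp
      | add y z _ _ h₁ h₂ => rw [add_mul]; exact add_mem h₁ h₂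
      | smul c y _ h => rw [smul_mul_assoc]; exact Submodule.smul_mem _ c h
    exact key a ha b hb
  star_mem' := by
    intro a ha
    have key : ∀ a ∈ Submodule.span ℂ s, star a ∈ Submodule.span ℂ s := by
      intro a ha
      induction ha using Submodule.span_induction with
      | mem x hx => exact Submodule.subset_span (hs x hx)
      | zero => simp
      | add y z _ _ h₁ h₂ => rw [star_add]; exact add_mem h₁ h₂
      | smul c y _ h => rw [star_smul]; exact Submodule.smul_mem _ _ h
    exact key a ha

variable (M) in
/-- `L₀(M)`, the linear span of the `ℓ(x, y)` in `E(M)`. -/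
def leftAlg₀ : NonUnitalStarSubalgebra ℂ (EndPair M) :=
  spanStarSubalgebra (Set.range fun p : M × M => ellPair p.1 p.2)
    (by rintro _ ⟨p, rfl⟩ _ ⟨q, rfl⟩; exact ⟨(p.1, tri q.2 q.1 p.2), (ellPair_mul _ _ _ _).symm⟩)
    (by rintro _ ⟨p, rfl⟩; exact ⟨(p.2, p.1), rfl⟩)

variable (M) in
/-- `R₀(M)`, the linear span of the `r(u, v)` in `E(M)`. -/
def rightAlg₀ : NonUnitalStarSubalgebra ℂ (EndPair M) :=
  spanStarSubalgebra (Set.range fun p : M × M => rPair p.1 p.2)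
    (by rintro _ ⟨p, rfl⟩ _ ⟨q, rfl⟩; exact ⟨(q.1, tri q.2 p.1 p.2), (rPair_mul _ _ _ _).symm⟩)
    (by rintro _ ⟨p, rfl⟩; exact ⟨(p.2, p.1), rfl⟩)

variable (M) in
/-- `L(M)`, the norm closure of `L₀(M)` in `E(M)`. -/
def leftAlg : NonUnitalStarSubalgebra ℂ (EndPair M) := (leftAlg₀ M).topologicalClosure

variable (M) in
/-- `R(M)`, the norm closure of `R₀(M)` in `E(M)`. -/
def rightAlg : NonUnitalStarSubalgebra ℂ (EndPair M) := (rightAlg₀ M).topologicalClosure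

/-- `ℓ(x, y)` as an element of `L(M)`. -/
def ell (x y : M) : leftAlg M :=
  ⟨ellPair x y, NonUnitalStarSubalgebra.le_topologicalClosure _
    (Submodule.subset_span ⟨(x, y), rfl⟩)⟩

/-- `r(u, v)` as an element of `R(M)`. -/
def rr (u v : M) : rightAlg M :=
  ⟨rPair u v, NonUnitalStarSubalgebra.le_topologicalClosure _
    (Submodule.subset_span ⟨(u, v), rfl⟩)⟩

@[simp] theorem coe_ell (x y : M) : (ell x y : EndPair M) = ellPair x y := rfl
@[simp] theorem coe_rr (x y : M) : (rr x y : EndPair M) = rPair x y := rfl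

theorem continuous_tri_mid (x z : M) : Continuous fun y => tri x y z :=
  (LinearMap.mkContinuous
    ({ toFun := fun y => tri x y z
       map_add' := fun y y' => tri_add_mid x y y' z
       map_smul' := fun c y => tri_smul_mid c x y z } : M →ₗ⋆[ℂ] M) (‖x‖ * ‖z‖)
    (fun y => (norm_tri_le x y z).trans_eq (by ring))).continuous

theorem continuous_tri_left (y z : M) : Continuous fun x => tri x y z :=
  (rightMul y z).continuous

theorem continuous_tri_right (x y : M) : Continuous fun z => tri x y z :=
  (leftMul x y).continuous

theorem tri_zero_left (y z : M) : tri 0 y z = 0 := (rightMul y z).map_zero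
theorem tri_zero_right (x y : M) : tri x y 0 = 0 := (leftMul x y).map_zero
theorem tri_zero_mid (x z : M) : tri x 0 z = 0 := by
  simpa using tri_smul_mid 0 x 0 z

theorem left_tri_mid (A : leftAlg M) (x g f : M) :
    tri x ((A : EndPair M).snd g) f = tri x g ((A : EndPair M).fst f) := by
  refine EndPair.closed_induction (P := fun A => tri x (A.snd g) f = tri x g (A.fst f)) ?_ ?_ ?_ ?_ ?_ A.2
  · exact isClosed_eq ((continuous_tri_mid x f).comp (EndPair.continuous_snd_apply g))
      ((continuous_tri_right x g).comp (EndPair.continuous_fst_apply f))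
  · rintro _ ⟨p, rfl⟩
    simp [tri_mid_right]
  · simp [tri_zero_mid, tri_zero_right]
  · intro A B hA hB
    simp [tri_add_mid, tri_add_right, hA, hB]
  · intro c A hA
    simp [tri_smul_mid, tri_smul_right, hA]

theorem left_tri_left (A : leftAlg M) (x g f : M) :
    tri ((A : EndPair M).fst x) g f = (A : EndPair M).fst (tri x g f) := by
  refine EndPair.closed_induction (P := fun A => tri (A.fst x) g f = A.fst (tri x g f))
    ?_ ?_ ?_ ?_ ?_ A.2
  · exact isClosed_eq ((continuous_tri_left g f).comp (EndPair.continuous_fst_apply x))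
      (EndPair.continuous_fst_apply _)
  · rintro _ ⟨p, rfl⟩
    simp [tri_assoc_right]
  · simp [tri_zero_left]
  · intro A B hA hB
    simp [tri_add_left, hA, hB]
  · intro c A hA
    simp [tri_smul_left, hA]

theorem right_tri_mid (B : rightAlg M) (x g f : M) :
    tri x ((B : EndPair M).snd g) f = tri ((B : EndPair M).fst x) g f := by
  refine EndPair.closed_induction (P := fun B => tri x (B.snd g) f = tri (B.fst x) g f)
    ?_ ?_ ?_ ?_ ?_ B.2
  · exact isClosed_eq ((continuous_tri_mid x f).comp (EndPair.continuous_snd_apply g))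
      ((continuous_tri_left g f).comp (EndPair.continuous_fst_apply x))
  · rintro _ ⟨p, rfl⟩
    simp [tri_assoc_mid]
  · simp [tri_zero_mid, tri_zero_left]
  · intro A B hA hB
    simp [tri_add_mid, tri_add_left, hA, hB]
  · intro c A hA
    simp [tri_smul_mid, tri_smul_left, hA]

theorem right_tri_right (B : rightAlg M) (x g f : M) :
    tri x g ((B : EndPair M).fst f) = (B : EndPair M).fst (tri x g f) := by
  refine EndPair.closed_induction (P := fun B => tri x g (B.fst f) = B.fst (tri x g f))
    ?_ ?_ ?_ ?_ ?_ B.2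
  · exact isClosed_eq ((continuous_tri_right x g).comp (EndPair.continuous_fst_apply f))
      (EndPair.continuous_fst_apply _)
  · rintro _ ⟨p, rfl⟩
    simp [tri_assoc_right]
  · simp [tri_zero_right]
  · intro A B hA hB
    simp [tri_add_right, hA, hB]
  · intro c A hA
    simp [tri_smul_right, hA]

theorem left_right_comm (A : leftAlg M) (B : rightAlg M) (x : M) :
    (B : EndPair M).fst ((A : EndPair M).fst x) = (A : EndPair M).fst ((B : EndPair M).fst x) := by
  refine EndPair.closed_induction (P := fun B => B.fst ((A : EndPair M).fst x)
    = (A : EndPair M).fst (B.fst x)) ?_ ?_ ?_ ?_ ?_ B.2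
  · exact isClosed_eq (EndPair.continuous_fst_apply _)
      ((A : EndPair M).fst.continuous.comp (EndPair.continuous_fst_apply x))
  · rintro _ ⟨p, rfl⟩
    simp [left_tri_left]
  · simp
  · intro B C hB hC
    simp [hB, hC]
  · intro c B hB
    simp [hB]

/-- The second components act on the conjugate side in the same way. -/
theorem left_right_comm' (A : leftAlg M) (B : rightAlg M) (x : M) :
    (B : EndPair M).snd ((A : EndPair M).snd x) = (A : EndPair M).snd ((B : EndPair M).snd x) :=
  left_right_comm (star A) (star B) x

theorem ell_mul (f g : M) (A : leftAlg M) :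
    ell f g * A = ell f ((A : EndPair M).snd g) := by
  apply Subtype.ext
  ext x
  · simp [left_tri_mid]
  · simpa using (left_tri_left (star A) g f x).symm

theorem mul_ell (f g : M) (A : leftAlg M) :
    A * ell f g = ell ((A : EndPair M).fst f) g := by
  apply Subtype.ext
  ext x
  · simp [left_tri_left]
  · simpa using (left_tri_mid (star A) g f x).symm

/-- `r(g, f·B) = r(g, f) ∘ B`, where `∘` is the product of `R(M)ᵒᵖ`. -/
theorem mul_rr (g f : M) (B : rightAlg M) :
    B * rr g f = rr g ((B : EndPair M).fst f) := by
  apply Subtype.ext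
  ext x
  · simp [right_tri_right]
  · simpa using (right_tri_mid (star B) x f g).symm

theorem rr_mul (g f : M) (B : rightAlg M) :
    rr g f * B = rr ((B : EndPair M).snd g) f := by
  apply Subtype.ext
  ext x
  · simp [right_tri_mid]
  · simpa using (right_tri_right (star B) x f g).symm

theorem ell_right (f g : M) (B : rightAlg M) :
    ell ((B : EndPair M).fst f) g = ell f ((B : EndPair M).snd g) := by
  apply Subtype.ext
  ext x
  · simp [right_tri_mid]
  · simpa using right_tri_mid (star B) g f x

theorem rr_left (g f : M) (A : leftAlg M) :
    rr ((A : EndPair M).snd g) f = rr g ((A : EndPair M).fst f) := by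
  apply Subtype.ext
  ext x
  · simp [left_tri_mid]
  · simpa using (left_tri_mid (star A) x f g).symm

theorem norm_fst_sq_le (B : rightAlg M) :
    ‖(B : EndPair M).fst‖ * ‖(B : EndPair M).fst‖
      ≤ ‖(B : EndPair M).snd * (B : EndPair M).fst‖ := by
  set S := (B : EndPair M).fst
  set T := (B : EndPair M).snd
  have key : ‖S‖ ≤ √‖T * S‖ := by
    refine S.opNorm_le_bound (Real.sqrt_nonneg _) fun x => ?_
    have h1 : ‖S x‖ ^ 3 ≤ ‖T * S‖ * ‖x‖ ^ 2 * ‖S x‖ := by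
      rw [← norm_tri_self, ← right_tri_mid B x (S x) (S x)]
      refine (norm_tri_le _ _ _).trans ?_
      have : ‖T (S x)‖ ≤ ‖T * S‖ * ‖x‖ := (T * S).le_opNorm x
      calc ‖x‖ * ‖T (S x)‖ * ‖S x‖ ≤ ‖x‖ * (‖T * S‖ * ‖x‖) * ‖S x‖ := by gcongr
        _ = _ := by ring
    have h2 : ‖S x‖ ^ 2 ≤ ‖T * S‖ * ‖x‖ ^ 2 := by
      rcases (norm_nonneg (S x)).eq_or_lt with h | h
      · have h0 : ‖S x‖ ^ 2 = 0 := by rw [← h]; simp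
        rw [h0]; positivity
      · refine le_of_mul_le_mul_right ?_ h
        calc ‖S x‖ ^ 2 * ‖S x‖ = ‖S x‖ ^ 3 := by ring
          _ ≤ _ := h1
    rw [← Real.sqrt_sq (norm_nonneg (S x)), ← Real.sqrt_sq (norm_nonneg x),
      ← Real.sqrt_mul (norm_nonneg _)]
    exact Real.sqrt_le_sqrt h2
  calc ‖S‖ * ‖S‖ ≤ √‖T * S‖ * √‖T * S‖ := by gcongr
    _ = _ := Real.mul_self_sqrt (norm_nonneg _)

instance : CStarRing (rightAlg M) where
  norm_mul_self_le B := by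
    have h1 := norm_fst_sq_le B
    have h2 := norm_fst_sq_le (star B)
    have e : ‖star B * B‖ = max ‖(B : EndPair M).snd * (B : EndPair M).fst‖
        ‖(B : EndPair M).snd * (B : EndPair M).fst‖ := rfl
    have e' : ‖B‖ = max ‖(B : EndPair M).fst‖ ‖(B : EndPair M).snd‖ := rfl
    have h3 := norm_mul_le (B : EndPair M).snd (B : EndPair M).fst
    have h2' : ‖(B : EndPair M).snd‖ * ‖(B : EndPair M).snd‖ ≤
      ‖(B : EndPair M).fst‖ * ‖(B : EndPair M).snd‖ := h2.trans (norm_mul_le _ _)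
    have n1 := norm_nonneg (B : EndPair M).fst
    have n2 := norm_nonneg (B : EndPair M).snd
    have h4 : ‖(B : EndPair M).snd‖ ≤ ‖(B : EndPair M).fst‖ := by
      by_contra! h
      nlinarith
    rw [e, e', max_self, max_eq_left h4]
    exact h1

instance : CompleteSpace (rightAlg M) :=
  (NonUnitalStarSubalgebra.isClosed_topologicalClosure (rightAlg₀ M)).completeSpace_coe

/-- `R(M)` is a C*-algebra. -/
instance : NonUnitalCStarAlgebra (rightAlg M) where

/-- `R(M)` carries the usual order of a C*-algebra: `B ≤ C` if and only if `C - B` is self-adjoint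
with non-negative spectrum. (`R(M)` and `R(M)ᵒᵖ` have the same positive elements.) -/
instance : PartialOrder (rightAlg M) := CStarAlgebra.spectralOrder (rightAlg M)

/-- The action `f · B = B₁ f` of `B = (B₁, B₂) ∈ R(M)` on `M`. It makes `M` a left `R(M)`-module,
that is, a right `R(M)ᵒᵖ`-module. -/
instance : SMul (rightAlg M) M := ⟨fun B f => (B : EndPair M).fst f⟩

theorem right_smul_def (B : rightAlg M) (f : M) : B • f = (B : EndPair M).fst f := rfl

/-- `M` is a right `R(M)ᵒᵖ`-Hilbert module: with the action `f · B = B₁ f` and with the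
`R(M)`-valued inner product `⟨f, g⟩ = r(g, f)` that gives back the triple product as
`[f g h] = f · ⟨h, g⟩`, all axioms of a Hilbert C*-module hold for the given norm of `M`.

In `CStarModule` the inner product is linear in the second variable, so that its `inner g f` is
`⟨f, g⟩`; and its axiom `inner g (B • f) = B * inner g f` for the left `R(M)`-module `M` reads
`⟨f · B, g⟩ = ⟨f, g⟩ ∘ B` in the product `∘` of `R(M)ᵒᵖ`. -/
def IsRightHilbertModule (M : Type*) [NormedAddCommGroup M] [NormedSpace ℂ M]
    [CStarTernaryRing M] : Prop :=
  ∃ H : CStarModule (rightAlg M) M, ∀ g f : M, H.inner g f = rr g f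

/-! ### The normed standard embedding -/

/-- The normed standard embedding `𝒜(M)`: matrices with rows `(A, f)` and `(ḡ, B)` where
`A ∈ L(M)`, `f ∈ M`, `ḡ ∈ M̄` (the conjugate space; the element `g` is stored) and `B ∈ R(M)ᵒᵖ`. -/
@[ext] structure StandardEmbedding (M : Type*) [NormedAddCommGroup M] [NormedSpace ℂ M]
    [CStarTernaryRing M] where
  ul : leftAlg M
  ur : M
  ll : M
  lr : rightAlg M

namespace StandardEmbedding

instance : Zero (StandardEmbedding M) := ⟨⟨0, 0, 0, 0⟩⟩
instance : Add (StandardEmbedding M) :=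
  ⟨fun a b => ⟨a.ul + b.ul, a.ur + b.ur, a.ll + b.ll, a.lr + b.lr⟩⟩
instance : Neg (StandardEmbedding M) := ⟨fun a => ⟨-a.ul, -a.ur, -a.ll, -a.lr⟩⟩

/-- The matrix product with entries `AA' + ℓ(f, g')`, `A·f' + f·B'`, `ḡ·A' + B·ḡ'` and
`r(g, f') + B ∘ B'`, where `A·f = A₁f`, `f·B = B₁f`, `ḡ·A` is the conjugate of `A₂g`, `B·ḡ` is the
conjugate of `B₂g`, and `B ∘ B' = B'B` is the product of `R(M)ᵒᵖ`. -/
instance : Mul (StandardEmbedding M) :=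
  ⟨fun a b =>
    ⟨a.ul * b.ul + ell a.ur b.ll,
      (a.ul : EndPair M).fst b.ur + (b.lr : EndPair M).fst a.ur,
      (b.ul : EndPair M).snd a.ll + (a.lr : EndPair M).snd b.ll,
      rr a.ll b.ur + b.lr * a.lr⟩⟩

/-- Scalars act on the conjugate space `M̄` through complex conjugation. -/
instance : SMul ℂ (StandardEmbedding M) :=
  ⟨fun c a => ⟨c • a.ul, c • a.ur, conj c • a.ll, c • a.lr⟩⟩

instance : Star (StandardEmbedding M) := ⟨fun a => ⟨star a.ul, a.ll, a.ur, star a.lr⟩⟩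

variable (a b : StandardEmbedding M) (c : ℂ)

@[simp] theorem zero_ul : (0 : StandardEmbedding M).ul = 0 := rfl
@[simp] theorem zero_ur : (0 : StandardEmbedding M).ur = 0 := rfl
@[simp] theorem zero_ll : (0 : StandardEmbedding M).ll = 0 := rfl
@[simp] theorem zero_lr : (0 : StandardEmbedding M).lr = 0 := rfl
@[simp] theorem add_ul : (a + b).ul = a.ul + b.ul := rfl
@[simp] theorem add_ur : (a + b).ur = a.ur + b.ur := rfl
@[simp] theorem add_ll : (a + b).ll = a.ll + b.ll := rfl
@[simp] theorem add_lr : (a + b).lr = a.lr + b.lr := rfl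
@[simp] theorem neg_ul : (-a).ul = -a.ul := rfl
@[simp] theorem neg_ur : (-a).ur = -a.ur := rfl
@[simp] theorem neg_ll : (-a).ll = -a.ll := rfl
@[simp] theorem neg_lr : (-a).lr = -a.lr := rfl
@[simp] theorem smul_ul : (c • a).ul = c • a.ul := rfl
@[simp] theorem smul_ur : (c • a).ur = c • a.ur := rfl
@[simp] theorem smul_ll : (c • a).ll = conj c • a.ll := rfl
@[simp] theorem smul_lr : (c • a).lr = c • a.lr := rfl
@[simp] theorem star_ul : (star a).ul = star a.ul := rfl
@[simp] theorem star_ur : (star a).ur = a.ll := rfl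
@[simp] theorem star_ll : (star a).ll = a.ur := rfl
@[simp] theorem star_lr : (star a).lr = star a.lr := rfl
@[simp] theorem mul_ul : (a * b).ul = a.ul * b.ul + ell a.ur b.ll := rfl
@[simp] theorem mul_ur :
    (a * b).ur = (a.ul : EndPair M).fst b.ur + (b.lr : EndPair M).fst a.ur := rfl
@[simp] theorem mul_ll :
    (a * b).ll = (b.ul : EndPair M).snd a.ll + (a.lr : EndPair M).snd b.ll := rfl
@[simp] theorem mul_lr : (a * b).lr = rr a.ll b.ur + b.lr * a.lr := rfl

instance : AddCommGroup (StandardEmbedding M) where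
  add_assoc a b c := by ext1 <;> simp [add_assoc]
  zero_add a := by ext1 <;> simp
  add_zero a := by ext1 <;> simp
  neg_add_cancel a := by ext1 <;> simp
  add_comm a b := by ext1 <;> simp [add_comm]
  nsmul := nsmulRec
  zsmul := zsmulRec

theorem ell_add_left (f f' g : M) : ell (f + f') g = ell f g + ell f' g := by
  apply Subtype.ext
  ext x <;> simp [tri_add_left, tri_add_mid]

theorem ell_add_right (f g g' : M) : ell f (g + g') = ell f g + ell f g' := by
  apply Subtype.ext
  ext x <;> simp [tri_add_left, tri_add_mid]

theorem rr_add_left (f f' g : M) : rr (f + f') g = rr f g + rr f' g := by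
  apply Subtype.ext
  ext x <;> simp [tri_add_right, tri_add_mid]

theorem rr_add_right (f g g' : M) : rr f (g + g') = rr f g + rr f g' := by
  apply Subtype.ext
  ext x <;> simp [tri_add_right, tri_add_mid]

theorem ell_smul_left (c : ℂ) (f g : M) : ell (c • f) g = c • ell f g := by
  apply Subtype.ext
  ext x <;> simp [tri_smul_left, tri_smul_mid]

theorem ell_smul_right (c : ℂ) (f g : M) : ell f (conj c • g) = c • ell f g := by
  apply Subtype.ext
  ext x <;> simp [tri_smul_left, tri_smul_mid]

theorem rr_smul_left (c : ℂ) (f g : M) : rr (conj c • f) g = c • rr f g := by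
  apply Subtype.ext
  ext x <;> simp [tri_smul_right, tri_smul_mid]

theorem rr_smul_right (c : ℂ) (f g : M) : rr f (c • g) = c • rr f g := by
  apply Subtype.ext
  ext x <;> simp [tri_smul_right, tri_smul_mid]

theorem ell_zero_left (g : M) : ell 0 g = 0 := by simpa using ell_smul_left 0 0 g
theorem ell_zero_right (g : M) : ell g 0 = 0 := by simpa using ell_smul_right 0 g 0
theorem rr_zero_left (g : M) : rr 0 g = 0 := by simpa using rr_smul_left 0 0 g
theorem rr_zero_right (g : M) : rr g 0 = 0 := by simpa using rr_smul_right 0 g 0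

theorem ell_fst (f g x : M) : (ell f g : EndPair M).fst x = tri f g x := rfl

instance : NonUnitalRing (StandardEmbedding M) where
  left_distrib a b c := by
    ext1 <;> simp [mul_add, add_mul, ell_add_right, rr_add_right] <;> abel
  right_distrib a b c := by
    ext1 <;> simp [mul_add, add_mul, ell_add_left, rr_add_left] <;> abel
  zero_mul a := by ext1 <;> simp [ell_zero_left, rr_zero_left]
  mul_zero a := by ext1 <;> simp [ell_zero_right, rr_zero_right]
  mul_assoc a b c := by
    ext1
    · simp [mul_add, add_mul, mul_assoc, ell_add_left, ell_add_right, ell_mul, mul_ell, ell_right]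
      abel
    · simp [left_right_comm]
      abel
    · simp [left_right_comm']
      abel
    · simp [mul_add, add_mul, mul_assoc, rr_add_left, rr_add_right, rr_mul, mul_rr, rr_left]
      abel

instance : StarRing (StandardEmbedding M) where
  star_involutive a := by ext1 <;> simp
  star_add a b := by ext1 <;> simp
  star_mul a b := by
    ext1
    · simp only [star_ul, mul_ul, star_add, star_mul, star_ur, star_ll]; rfl
    · simp
    · simp
    · simp only [star_lr, mul_lr, star_add, star_mul, star_ur, star_ll]; rfl

instance : Module ℂ (StandardEmbedding M) where
  one_smul a := by ext1 <;> simp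
  mul_smul c d a := by ext1 <;> simp [mul_smul]
  smul_zero c := by ext1 <;> simp
  smul_add c a b := by ext1 <;> simp
  add_smul c d a := by ext1 <;> simp [add_smul]
  zero_smul a := by ext1 <;> simp

instance : StarModule ℂ (StandardEmbedding M) where
  star_smul c a := by ext1 <;> simp

instance : IsScalarTower ℂ (StandardEmbedding M) (StandardEmbedding M) where
  smul_assoc c a b := by
    ext1 <;> simp [ell_smul_left, rr_smul_left, smul_mul_assoc, mul_smul_comm]

instance : SMulCommClass ℂ (StandardEmbedding M) (StandardEmbedding M) where
  smul_comm c a b := by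
    ext1 <;> simp [ell_smul_right, rr_smul_right, smul_mul_assoc, mul_smul_comm]

end StandardEmbedding

end CStarTernaryRing

/-- A complex *-algebra `A` can be normed to be a C*-algebra: there is a complete submultiplicative
vector space norm `ν` on `A` with `ν(a*a) = ν(a)²`. -/
def CanBeNormedCStarAlgebra (A : Type*) [NonUnitalRing A] [StarRing A] [Module ℂ A] : Prop :=
  ∃ ν : RingNorm A,
    (∀ (c : ℂ) (a : A), ν (c • a) = ‖c‖ * ν a) ∧
    (∀ a : A, ν (star a * a) = ν a ^ 2) ∧
    ∀ u : ℕ → A, (∀ ε > 0, ∃ N, ∀ m ≥ N, ∀ n ≥ N, ν (u m - u n) < ε) →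
      ∃ a : A, ∀ ε > 0, ∃ N, ∀ n ≥ N, ν (u n - a) < ε

end

/-!
Both directions turn on the positivity of `r(f, f)` in `R(M)`. All the other axioms of a Hilbert
C*-module hold in every C*-ternary ring; in particular `‖r(f, f)‖ = ‖f‖²` follows from
`‖[fff]‖ = ‖f‖³`.

Suppose that `𝒜(M)` has a C*-norm. The matrix with the single entry `f` in the upper right corner
has `a#a` equal to the matrix with the single entry `r(f, f)`, so that `r(f, f)` is positive in
`𝒜(M)`. To carry this back to `R(M)`, let `c` be the negative part of `b = r(f, f)` and write
`c = e*e`. Then `r(c·f, c·f) = cbc = -c³ = -(ec)*(ec)`, hence in `𝒜(M)` a sum `x#x + y#y` vanishes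
whose second term comes from `ec`. In a C*-algebra this forces `ec = 0`, so `c² = e*ec = 0` and
`b = b⁺ ≥ 0` (`rr_self_nonneg`).

Suppose conversely that `M` is a Hilbert module. Then so is the space `M ⊕ R(M)` of second columns,
on which `𝒜(M)` acts by left multiplication (`colMul`). This is a *-representation by adjointable
operators (`colMul_mul`, `inner_colMul`), and adjointable operators satisfy the C*-identity
(`CStarModule.sq_norm_le_of_adjoint`). The operator norm dominates the norm of each of the four
entries and is dominated by their sum, so it is a complete norm (`exists_limit`).
-/

universe u

/-! ### Two facts on C*-algebras and Hilbert C*-modules -/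

/-- A C*-norm makes `A` a C*-algebra, in which `a*a ≥ 0`. -/
theorem CanBeNormedCStarAlgebra.eq_zero_of_star_mul_self_add_eq_zero {A : Type*} [NonUnitalRing A]
    [StarRing A] [Module ℂ A] [IsScalarTower ℂ A A] [SMulCommClass ℂ A A] [StarModule ℂ A]
    (hA : CanBeNormedCStarAlgebra A) {x y : A} (h : star x * x + star y * y = 0) : y = 0 := by
  obtain ⟨ν, hsmul, hstar, hcomplete⟩ := hA
  let _ : NonUnitalNormedRing A :=
    { ‹NonUnitalRing A› with
      norm := ν
      dist := fun x y => ν (-x + y)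
      dist_eq := fun _ _ => rfl
      dist_self := fun x => by simp
      dist_comm := fun x y => by rw [← map_neg_eq_map ν]; congr 1; abel
      dist_triangle := fun x y z => by
        have := map_add_le_add ν (-x + y) (-y + z)
        rwa [show -x + y + (-y + z) = -x + z by abel] at this
      norm_mul_le := map_mul_le_mul ν
      eq_of_dist_eq_zero := fun {x y} hxy =>
        (neg_add_eq_zero.mp (eq_zero_of_map_eq_zero ν hxy)) }
  have hnorm : ∀ a : A, ‖a‖ = ν a := fun _ => rfl
  let _ : NormedSpace ℂ A := { ‹Module ℂ A› with norm_smul_le := fun c a => (hsmul c a).le }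
  have : CStarRing A := ⟨fun a => by rw [hnorm, hnorm, hstar, sq]⟩
  have : CompleteSpace A := by
    refine Metric.complete_of_cauchySeq_tendsto fun u hu => ?_
    rw [Metric.cauchySeq_iff] at hu
    obtain ⟨a, ha⟩ := hcomplete u (by simpa only [dist_eq_norm, hnorm] using hu)
    exact ⟨a, Metric.tendsto_atTop.mpr (by simpa only [dist_eq_norm, hnorm] using ha)⟩
  let _ : NonUnitalCStarAlgebra A := { }
  let _ : PartialOrder A := CStarAlgebra.spectralOrder A
  have : StarOrderedRing A := CStarAlgebra.spectralOrderedRing A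
  have hy : star y * y = 0 :=
    ((add_eq_zero_iff_of_nonneg (star_mul_self_nonneg x) (star_mul_self_nonneg y)).mp h).2
  exact (CStarRing.star_mul_self_eq_zero_iff y).mp hy

/-- The C*-identity for adjointable operators on a Hilbert C*-module, as an inequality. -/
theorem CStarModule.sq_norm_le_of_adjoint {A E : Type*} [NonUnitalCStarAlgebra A] [PartialOrder A]
    [StarOrderedRing A] [SMul A E] [NormedAddCommGroup E] [NormedSpace ℂ E] [CStarModule A E]
    {S T : E →L[ℂ] E} (h : ∀ x y, inner A (T x) y = inner A x (S y)) :
    ‖T‖ ^ 2 ≤ ‖S * T‖ := by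
  have key : ‖T‖ ≤ √‖S * T‖ := by
    refine T.opNorm_le_bound (Real.sqrt_nonneg _) fun x => ?_
    rw [← Real.sqrt_sq (norm_nonneg x), ← Real.sqrt_mul (norm_nonneg _)]
    refine Real.le_sqrt_of_sq_le ?_
    calc ‖T x‖ ^ 2 = ‖inner A x (S (T x))‖ := by rw [CStarModule.norm_sq_eq A, h]
      _ ≤ ‖x‖ * ‖(S * T) x‖ := CStarModule.norm_inner_le E
      _ ≤ ‖x‖ * (‖S * T‖ * ‖x‖) := by gcongr; exact (S * T).le_opNorm x
      _ = ‖S * T‖ * ‖x‖ ^ 2 := by ring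
  calc ‖T‖ ^ 2 ≤ √‖S * T‖ ^ 2 := by gcongr
    _ = ‖S * T‖ := Real.sq_sqrt (norm_nonneg _)

/-! ### Positivity of `r(f, f)` -/

namespace CStarTernaryRing

variable {M : Type*} [NormedAddCommGroup M] [NormedSpace ℂ M] [CStarTernaryRing M]

instance : StarOrderedRing (rightAlg M) := CStarAlgebra.spectralOrderedRing _

instance : CompleteSpace (leftAlg M) :=
  (NonUnitalStarSubalgebra.isClosed_topologicalClosure (leftAlg₀ M)).completeSpace_coe

@[simp] theorem star_rr (x y : M) : star (rr x y) = rr y x := Subtype.ext (star_rPair x y)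

theorem rr_self_apply (f : M) : (rr f f : EndPair M).fst f = tri f f f := rfl

theorem norm_rr_le (g k : M) : ‖rr g k‖ ≤ ‖g‖ * ‖k‖ :=
  have h (y z : M) : ‖(rightMul y z : M →L[ℂ] M)‖ ≤ ‖y‖ * ‖z‖ :=
    LinearMap.mkContinuous_norm_le _ (by positivity) _
  max_le (h g k) ((h k g).trans_eq (mul_comm _ _))

theorem norm_right_smul_le (B : rightAlg M) (f : M) : ‖B • f‖ ≤ ‖B‖ * ‖f‖ :=
  ((B : EndPair M).fst.le_opNorm f).trans (by gcongr; exact le_max_left _ _)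

theorem norm_left_fst_le (A : leftAlg M) (f : M) : ‖(A : EndPair M).fst f‖ ≤ ‖A‖ * ‖f‖ :=
  ((A : EndPair M).fst.le_opNorm f).trans (by gcongr; exact le_max_left _ _)

theorem norm_rr_self (f : M) : ‖rr f f‖ = ‖f‖ ^ 2 := by
  refine le_antisymm ((norm_rr_le f f).trans_eq (sq _).symm) ?_
  rcases (norm_nonneg f).eq_or_lt with h | h
  · rw [← h]; simp
  · refine le_of_mul_le_mul_right ?_ h
    calc ‖f‖ ^ 2 * ‖f‖ = ‖rr f f • f‖ := by rw [right_smul_def, rr_self_apply, norm_tri_self]; ring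
      _ ≤ ‖rr f f‖ * ‖f‖ := norm_right_smul_le _ _

/-- If `𝒜(M)` is a C*-algebra, then `r(f, f)` is positive already in `R(M)`. -/
theorem rr_self_nonneg (hM : CanBeNormedCStarAlgebra (StandardEmbedding M)) (f : M) :
    0 ≤ rr f f := by
  have hsa : IsSelfAdjoint (rr f f) := star_rr f f
  set b := rr f f with hb
  suffices hc : b⁻ = 0 by
    rw [← CFC.posPart_sub_negPart b hsa, hc, sub_zero]
    exact CFC.posPart_nonneg b
  have hcsa : IsSelfAdjoint b⁻ := .of_nonneg (CFC.negPart_nonneg b)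
  -- The negative part `c` satisfies `c b c = -c³`, and `c³ = (e c)* (e c)` for `c = e* e`.
  obtain ⟨e, he⟩ := CStarAlgebra.nonneg_iff_eq_star_mul_self.mp (CFC.negPart_nonneg b)
  have hcbc : b⁻ * b * b⁻ = -(star (e * b⁻) * (e * b⁻)) := by
    have h1 : b⁻ * b = -(b⁻ * b⁻) := by
      nth_rw 2 [← CFC.posPart_sub_negPart b hsa]
      rw [mul_sub, CFC.negPart_mul_posPart, zero_sub]
    rw [h1, star_mul, hcsa.star_eq, mul_assoc, ← mul_assoc (star e), ← he]
    noncomm_ring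
  -- `B ↦ (0, 0; 0, B)` reverses products, so that the element `y` with `y# y` equal to the image of
  -- `(e c)* (e c)` is the image of `(e c)*`.
  have hw : star (e * b⁻) = 0 := by
    have h := hM.eq_zero_of_star_mul_self_add_eq_zero
      (x := ⟨0, (b⁻ : rightAlg M) • f, 0, 0⟩) (y := ⟨0, 0, 0, star (e * b⁻)⟩) ?_
    · exact congrArg StandardEmbedding.lr h
    · have h2 : rr ((b⁻ : rightAlg M) • f) ((b⁻ : rightAlg M) • f) = b⁻ * b * b⁻ := by
        rw [right_smul_def, ← mul_rr, hb, mul_assoc, rr_mul]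
        congr 3
        exact congrArg (fun B : rightAlg M => (B : EndPair M).fst) hcsa.star_eq.symm
      ext1
      · simp [StandardEmbedding.ell_zero_left]
      · simp
      · simp
      · simp only [StandardEmbedding.add_lr, StandardEmbedding.mul_lr, StandardEmbedding.star_ll,
          StandardEmbedding.star_lr, StandardEmbedding.rr_zero_left, star_star, h2, hcbc]
        simp
  have hec : e * b⁻ = 0 := star_eq_zero.mp hw
  refine (CStarRing.star_mul_self_eq_zero_iff b⁻).mp ?_
  rw [hcsa.star_eq]
  nth_rw 1 [he]
  rw [mul_assoc, hec, mul_zero]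

/-- Positivity of `r(f, f)` is the only axiom of a Hilbert module that can fail. -/
theorem isRightHilbertModule_of_rr_self_nonneg (h : ∀ f : M, 0 ≤ rr f f) :
    IsRightHilbertModule M :=
  ⟨{ inner := rr
     inner_add_right := StandardEmbedding.rr_add_right _ _ _
     inner_self_nonneg := h _
     inner_self := fun {f} => ⟨fun hf => by
       have := norm_rr_self f
       rw [hf, norm_zero] at this
       exact norm_eq_zero.mp (pow_eq_zero_iff two_ne_zero |>.mp this.symm),
       fun hf => by rw [hf, StandardEmbedding.rr_zero_left]⟩
     inner_op_smul_right := (mul_rr _ _ _).symm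
     inner_smul_right_complex := StandardEmbedding.rr_smul_right _ _ _
     star_inner := star_rr
     norm_eq_sqrt_norm_inner_self := fun f => by
       rw [norm_rr_self, Real.sqrt_sq (norm_nonneg f)] }, fun _ _ => rfl⟩

/-! ### The representation of `𝒜(M)` on second columns -/

open scoped InnerProductSpace

namespace StandardEmbedding

@[simp] theorem sub_ul (a b : StandardEmbedding M) : (a - b).ul = a.ul - b.ul := by
  simp [sub_eq_add_neg]
@[simp] theorem sub_ur (a b : StandardEmbedding M) : (a - b).ur = a.ur - b.ur := by
  simp [sub_eq_add_neg]
@[simp] theorem sub_ll (a b : StandardEmbedding M) : (a - b).ll = a.ll - b.ll := by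
  simp [sub_eq_add_neg]
@[simp] theorem sub_lr (a b : StandardEmbedding M) : (a - b).lr = a.lr - b.lr := by
  simp [sub_eq_add_neg]

variable (M) in
/-- The space `M ⊕ R(M)` of second columns of elements of `𝒜(M)`. It is a separate type, so that
its additive structure is that of its norm as a Hilbert C*-module. -/
def Column : Type _ := WithCStarModule (rightAlg M) (M × rightAlg M)

/-- The second column `(h, C)`. -/
def col (h : M) (C : rightAlg M) : Column M :=
  (WithCStarModule.equiv (rightAlg M) (M × rightAlg M)).symm (h, C)

@[simp] theorem col_fst (h : M) (C : rightAlg M) : (col h C).1 = h := rfl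
@[simp] theorem col_snd (h : M) (C : rightAlg M) : (col h C).2 = C := rfl

@[ext] theorem Column.ext {v w : Column M} (h₁ : v.1 = w.1) (h₂ : v.2 = w.2) : v = w :=
  Prod.ext h₁ h₂

variable [CStarModule (rightAlg M) M]

noncomputable instance : NormedAddCommGroup (Column M) :=
  inferInstanceAs (NormedAddCommGroup (WithCStarModule (rightAlg M) (M × rightAlg M)))

noncomputable instance : NormedSpace ℂ (Column M) :=
  inferInstanceAs (NormedSpace ℂ (WithCStarModule (rightAlg M) (M × rightAlg M)))

noncomputable instance : SMul (rightAlg M) (Column M) :=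
  inferInstanceAs (SMul (rightAlg M) (WithCStarModule (rightAlg M) (M × rightAlg M)))

noncomputable instance : CStarModule (rightAlg M) (Column M) :=
  inferInstanceAs (CStarModule (rightAlg M) (WithCStarModule (rightAlg M) (M × rightAlg M)))

@[simp] theorem Column.add_fst (v w : Column M) : (v + w).1 = v.1 + w.1 := rfl
@[simp] theorem Column.add_snd (v w : Column M) : (v + w).2 = v.2 + w.2 := rfl
@[simp] theorem Column.smul_fst (c : ℂ) (v : Column M) : (c • v).1 = c • v.1 := rfl
@[simp] theorem Column.smul_snd (c : ℂ) (v : Column M) : (c • v).2 = c • v.2 := rfl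

theorem Column.inner_def (v w : Column M) :
    ⟪v, w⟫_(rightAlg M) = ⟪v.1, w.1⟫_(rightAlg M) + w.2 * star v.2 := rfl

theorem norm_fst_le (v : Column M) : ‖v.1‖ ≤ ‖v‖ :=
  (le_max_left _ _).trans (WithCStarModule.max_le_prod_norm v)

theorem norm_snd_le (v : Column M) : ‖v.2‖ ≤ ‖v‖ :=
  (le_max_right _ _).trans (WithCStarModule.max_le_prod_norm v)

theorem norm_col_le (h : M) (C : rightAlg M) : ‖col h C‖ ≤ ‖h‖ + ‖C‖ :=
  WithCStarModule.prod_norm_le_norm_add _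

/-- Left multiplication by an element of `𝒜(M)` on second columns. -/
noncomputable def colMul (a : StandardEmbedding M) : Column M →L[ℂ] Column M :=
  LinearMap.mkContinuous
    { toFun := fun v => col ((a.ul : EndPair M).fst v.1 + v.2 • a.ur) (rr a.ll v.1 + v.2 * a.lr)
      map_add' := fun v w => by
        ext1
        · simp [right_smul_def]; abel
        · simp [rr_add_right, add_mul]; abel
      map_smul' := fun c v => by
        ext1
        · simp [right_smul_def]
        · simp [rr_smul_right, smul_mul_assoc] }
    (‖a.ul‖ + ‖a.ur‖ + ‖a.ll‖ + ‖a.lr‖) fun v => by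
      have h1 := norm_fst_le v
      have h2 := norm_snd_le v
      refine (norm_col_le _ _).trans ?_
      calc _ ≤ (‖(a.ul : EndPair M).fst v.1‖ + ‖v.2 • a.ur‖) + (‖rr a.ll v.1‖ + ‖v.2 * a.lr‖) :=
            add_le_add (norm_add_le _ _) (norm_add_le _ _)
        _ ≤ (‖a.ul‖ * ‖v.1‖ + ‖v.2‖ * ‖a.ur‖) + (‖a.ll‖ * ‖v.1‖ + ‖v.2‖ * ‖a.lr‖) := by
            gcongr
            · exact norm_left_fst_le _ _
            · exact norm_right_smul_le _ _
            · exact norm_rr_le _ _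
            · exact norm_mul_le _ _
        _ ≤ (‖a.ul‖ * ‖v‖ + ‖v‖ * ‖a.ur‖) + (‖a.ll‖ * ‖v‖ + ‖v‖ * ‖a.lr‖) := by gcongr
        _ = _ := by ring

variable (a b : StandardEmbedding M)

@[simp] theorem colMul_fst (v : Column M) :
    (colMul a v).1 = (a.ul : EndPair M).fst v.1 + v.2 • a.ur := rfl

@[simp] theorem colMul_snd (v : Column M) : (colMul a v).2 = rr a.ll v.1 + v.2 * a.lr := rfl

theorem norm_colMul_le : ‖colMul a‖ ≤ ‖a.ul‖ + ‖a.ur‖ + ‖a.ll‖ + ‖a.lr‖ :=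
  LinearMap.mkContinuous_norm_le _ (by positivity) _

theorem colMul_add : colMul (a + b) = colMul a + colMul b := by
  refine ContinuousLinearMap.ext fun v => Column.ext ?_ ?_
  · simp [right_smul_def]; abel
  · simp [rr_add_left, mul_add]; abel

theorem colMul_smul (c : ℂ) : colMul (c • a) = c • colMul a := by
  refine ContinuousLinearMap.ext fun v => Column.ext ?_ ?_
  · simp [right_smul_def]
  · simp [rr_smul_left, mul_smul_comm]

theorem colMul_mul : colMul (a * b) = colMul a * colMul b := by
  refine ContinuousLinearMap.ext fun v => Column.ext ?_ ?_
  · simp [right_smul_def, left_right_comm]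
    abel
  · simp [right_smul_def, mul_add, add_mul, mul_assoc, rr_add_right, rr_add_left, mul_rr, rr_mul,
      rr_left]
    abel

/-- Left multiplication on columns is adjointable, with adjoint the left multiplication by `a#`. -/
theorem inner_colMul (hin : ∀ g f : M, ⟪g, f⟫_(rightAlg M) = rr g f) (v w : Column M) :
    ⟪colMul a v, w⟫_(rightAlg M) = ⟪v, colMul (star a) w⟫_(rightAlg M) := by
  have h : rr ((v.2 : EndPair M).fst a.ur) w.1 = rr a.ur w.1 * star v.2 :=
    (rr_mul a.ur w.1 (star v.2)).symm
  have h' : rr v.1 ((w.2 : EndPair M).fst a.ll) = w.2 * rr v.1 a.ll := (mul_rr _ _ _).symm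
  have h'' : rr ((a.ul : EndPair M).fst v.1) w.1 = rr v.1 ((a.ul : EndPair M).snd w.1) :=
    rr_left v.1 w.1 (star a.ul)
  simp [Column.inner_def, hin, right_smul_def, rr_add_left, rr_add_right, h, h', h'', add_mul,
    mul_add, mul_assoc]
  abel

/-! ### The operator norm of `𝒜(M)` -/

theorem norm_colMul_col_le (C : rightAlg M) : ‖colMul a (col 0 C)‖ ≤ ‖colMul a‖ * ‖C‖ :=
  ((colMul a).le_opNorm _).trans (by gcongr; simpa using norm_col_le (0 : M) C)

/-- Evaluate at the column `(0, r(f, f))`, where `f` is the upper right entry. -/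
theorem norm_ur_le : ‖a.ur‖ ≤ ‖colMul a‖ := by
  rcases (norm_nonneg a.ur).eq_or_lt with h | h
  · rw [← h]; positivity
  · refine le_of_mul_le_mul_right ?_ (pow_pos h 2)
    calc ‖a.ur‖ * ‖a.ur‖ ^ 2 = ‖(colMul a (col 0 (rr a.ur a.ur))).1‖ := by
          simp [right_smul_def, norm_tri_self]; ring
      _ ≤ ‖colMul a‖ * ‖rr a.ur a.ur‖ := (norm_fst_le _).trans (norm_colMul_col_le a _)
      _ = ‖colMul a‖ * ‖a.ur‖ ^ 2 := by rw [norm_rr_self]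

/-- Evaluate at the column `(0, B*)`, where `B` is the lower right entry. -/
theorem norm_lr_le : ‖a.lr‖ ≤ ‖colMul a‖ := by
  rcases (norm_nonneg a.lr).eq_or_lt with h | h
  · rw [← h]; positivity
  · refine le_of_mul_le_mul_right ?_ h
    calc ‖a.lr‖ * ‖a.lr‖ = ‖(colMul a (col 0 (star a.lr))).2‖ := by
          simp [rr_zero_right, CStarRing.norm_star_mul_self]
      _ ≤ ‖colMul a‖ * ‖star a.lr‖ := (norm_snd_le _).trans (norm_colMul_col_le a _)
      _ = ‖colMul a‖ * ‖a.lr‖ := by rw [norm_star]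

theorem norm_fst_ul_le : ‖(a.ul : EndPair M).fst‖ ≤ ‖colMul a‖ := by
  refine ContinuousLinearMap.opNorm_le_bound _ (norm_nonneg _) fun h => ?_
  calc ‖(a.ul : EndPair M).fst h‖ = ‖(colMul a (col h 0)).1‖ := by simp [right_smul_def]
    _ ≤ ‖colMul a (col h 0)‖ := norm_fst_le _
    _ ≤ ‖colMul a‖ * ‖col h 0‖ := (colMul a).le_opNorm _
    _ ≤ ‖colMul a‖ * ‖h‖ := by
      gcongr
      simpa using norm_col_le h 0

variable {a b}

theorem norm_colMul_star_le (hin : ∀ g f : M, inner (rightAlg M) g f = rr g f) :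
    ‖colMul (star a)‖ ≤ ‖colMul a‖ := by
  have h := (CStarModule.sq_norm_le_of_adjoint (inner_colMul (star a) hin)).trans (norm_mul_le _ _)
  rw [star_star, sq] at h
  by_contra! hlt
  exact absurd h (not_le.mpr (mul_lt_mul_of_pos_right hlt ((norm_nonneg _).trans_lt hlt)))

theorem norm_ul_le (hin : ∀ g f : M, inner (rightAlg M) g f = rr g f) : ‖a.ul‖ ≤ ‖colMul a‖ :=
  max_le (norm_fst_ul_le a) ((norm_fst_ul_le (star a)).trans (norm_colMul_star_le hin))

theorem norm_ll_le (hin : ∀ g f : M, inner (rightAlg M) g f = rr g f) : ‖a.ll‖ ≤ ‖colMul a‖ :=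
  (norm_ur_le (star a)).trans (norm_colMul_star_le hin)

theorem norm_colMul_star_mul_self (hin : ∀ g f : M, inner (rightAlg M) g f = rr g f) :
    ‖colMul (star a * a)‖ = ‖colMul a‖ ^ 2 := by
  rw [colMul_mul]
  refine le_antisymm ?_ (CStarModule.sq_norm_le_of_adjoint (inner_colMul a hin))
  rw [sq]
  exact (norm_mul_le _ _).trans (by gcongr; exact norm_colMul_star_le hin)

theorem eq_zero_of_norm_colMul_eq_zero (hin : ∀ g f : M, inner (rightAlg M) g f = rr g f)
    (h : ‖colMul a‖ = 0) : a = 0 := by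
  ext1
  · exact norm_le_zero_iff.mp ((norm_ul_le hin).trans_eq h)
  · exact norm_le_zero_iff.mp ((norm_ur_le a).trans_eq h)
  · exact norm_le_zero_iff.mp ((norm_ll_le hin).trans_eq h)
  · exact norm_le_zero_iff.mp ((norm_lr_le a).trans_eq h)

theorem colMul_neg : colMul (-a) = -colMul a := by
  rw [← neg_one_smul ℂ a, colMul_smul, neg_one_smul]

/-- The norm of `𝒜(M)` as operators on the Hilbert module of second columns. -/
noncomputable def colNorm (hin : ∀ g f : M, inner (rightAlg M) g f = rr g f) :
    RingNorm (StandardEmbedding M) where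
  toFun a := ‖colMul a‖
  map_zero' := by
    have h := colMul_smul (0 : StandardEmbedding M) 0
    rw [zero_smul, zero_smul] at h
    rw [h, norm_zero]
  add_le' a b := by rw [colMul_add]; exact norm_add_le _ _
  neg' a := by rw [colMul_neg, norm_neg]
  mul_le' a b := by rw [colMul_mul]; exact norm_mul_le _ _
  eq_zero_of_map_eq_zero' _ h := eq_zero_of_norm_colMul_eq_zero hin h

/-- The operator norm is equivalent to the maximum norm of the four entries, which lie in complete
spaces. -/
theorem exists_limit {M : Type u} [NormedAddCommGroup M] [NormedSpace ℂ M] [CStarTernaryRing M]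
    [CStarModule (rightAlg M) M] (hin : ∀ g f : M, inner (rightAlg M) g f = rr g f)
    {u : ℕ → StandardEmbedding M}
    (hu : ∀ ε > 0, ∃ N, ∀ m ≥ N, ∀ n ≥ N, ‖colMul (u m - u n)‖ < ε) :
    ∃ a, ∀ ε > 0, ∃ N, ∀ n ≥ N, ‖colMul (u n - a)‖ < ε := by
  have key {X : Type u} [NormedAddCommGroup X] [CompleteSpace X] (p : StandardEmbedding M → X)
      (hp : ∀ a b, ‖p a - p b‖ ≤ ‖colMul (a - b)‖) :
      ∃ x, Filter.Tendsto (fun n => ‖p (u n) - x‖) .atTop (nhds 0) := by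
    have hc : CauchySeq fun n => p (u n) := Metric.cauchySeq_iff.mpr fun ε hε =>
      (hu ε hε).imp fun N hN m hm n hn => by
        rw [dist_eq_norm]; exact (hp _ _).trans_lt (hN m hm n hn)
    obtain ⟨x, hx⟩ := cauchySeq_tendsto_of_complete hc
    exact ⟨x, tendsto_iff_norm_sub_tendsto_zero.mp hx⟩
  obtain ⟨A, hA⟩ := key ul fun a b => by rw [← sub_ul]; exact norm_ul_le hin
  obtain ⟨f, hf⟩ := key ur fun a b => by rw [← sub_ur]; exact norm_ur_le _
  obtain ⟨g, hg⟩ := key ll fun a b => by rw [← sub_ll]; exact norm_ll_le hin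
  obtain ⟨B, hB⟩ := key lr fun a b => by rw [← sub_lr]; exact norm_lr_le _
  have hsum := ((hA.add hf).add hg).add hB
  simp only [add_zero] at hsum
  refine ⟨⟨A, f, g, B⟩, fun ε hε => ?_⟩
  obtain ⟨N, hN⟩ := Filter.eventually_atTop.mp (hsum.eventually_lt_const hε)
  exact ⟨N, fun n hn => (norm_colMul_le _).trans_lt (by simpa using hN n hn)⟩

end StandardEmbedding

theorem IsRightHilbertModule.canBeNormedCStarAlgebra (h : IsRightHilbertModule M) :
    CanBeNormedCStarAlgebra (StandardEmbedding M) := by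
  obtain ⟨H, hin⟩ := h
  refine ⟨StandardEmbedding.colNorm hin, fun c a => ?_,
    fun a => StandardEmbedding.norm_colMul_star_mul_self hin,
    fun u hu => StandardEmbedding.exists_limit hin hu⟩
  change ‖StandardEmbedding.colMul (c • a)‖ = ‖c‖ * ‖StandardEmbedding.colMul a‖
  rw [StandardEmbedding.colMul_smul, norm_smul]

end CStarTernaryRing

theorem mainTheorem7 {M : Type*} [NormedAddCommGroup M] [NormedSpace ℂ M] [CStarTernaryRing M] :
    CanBeNormedCStarAlgebra (CStarTernaryRing.StandardEmbedding M) ↔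
      CStarTernaryRing.IsRightHilbertModule M :=
  ⟨fun h => CStarTernaryRing.isRightHilbertModule_of_rr_self_nonneg
      (CStarTernaryRing.rr_self_nonneg h),
    CStarTernaryRing.IsRightHilbertModule.canBeNormedCStarAlgebra⟩
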